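/- For a finite field $F$ of characteristic $2$ and a function $h:F\to F$, let $\delta_h=\max_{a\in F\setminus\{0\},\,b\in F}\left|\{x\in F : h(x+a)+h(x)=b\}\right|$ be its differential uniformity; $h$ is called differentially $m$-uniform if $\delta_h=m$, and almost perfect nonlinear (APN) if $\delta_h=2$. Let $k$ be an odd positive integer, $n=5k$ and $d=2^{4k}+2^{3k}+2^{2k}+2^{k}-1$. Let $g$ be a function on $\mathbb{F}_{2^n}$ that maps $\mathbb{F}_{2^k}$ bijectively onto itself (for instance, one given by a polynomial over $\mathbb{F}_{2^k}$ that permutes $\mathbb{F}_{2^k}$), and define $$f(x)=g(x)+\bigl(g(x)+x^{d}\bigr)\bigl(x+x^{2^k}\bigr)^{2^n-1},\qquad x\in\mathbb{F}_{2^n}.$$ Then $f(x)=g(x)$ for $x\in\mathbb{F}_{2^k}$, $f(x)=x^d$ for $x\in\mathbb{F}_{2^n}\setminus\mathbb{F}_{2^k}$, and $f$ is a permutation of $\mathbb{F}_{2^n}$. Moreover: (i) if the restriction of $g$ to $\mathbb{F}_{2^k}$ is APN, then $\delta_f\le 4$; if it is differentially $4$-uniform, then $f$ is differentially $4$-uniform,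 that is, $\delta_f=4$; (ii) if the restriction of $g$ to $\mathbb{F}_{2^k}$ is differentially $6$-uniform, then $f$ is differentially $6$-uniform, that is, $\delta_f=6$. -/

import Mathlib

/-- The number `δ_f(a,b)` of solutions `x` of `f (x + a) + f x = b`. -/
noncomputable def diffCount {F : Type*} [Field F] (f : F → F) (a b : F) : ℕ :=
  Set.ncard {x : F | f (x + a) + f x = b}

open Classical in
/-- The differential uniformity `δ_f`: the maximum of `δ_f(a,b)` over all `a ≠ 0` and all `b`. -/
noncomputable def diffUniformity {F : Type*} [Field F] [Fintype F] (f : F → F) : ℕ :=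
  (Finset.univ.filter fun p : F × F => p.1 ≠ 0).sup fun p => diffCount f p.1 p.2

/-- `f` is differentially `m`-uniform: its differential uniformity is exactly `m`. -/
def IsDiffUniform {F : Type*} [Field F] [Fintype F] (f : F → F) (m : ℕ) : Prop :=
  diffUniformity f = m

/-- `f` is almost perfect nonlinear: its differential uniformity is `2`. -/
def IsAPN {F : Type*} [Field F] [Fintype F] (f : F → F) : Prop :=
  IsDiffUniform f 2

/-- The exponent `d = 2^{4k} + 2^{3k} + 2^{2k} + 2^k - 1` (the subtraction never truncates). -/
def dobbertinExp (k : ℕ) : ℕ :=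
  2 ^ (4 * k) + 2 ^ (3 * k) + 2 ^ (2 * k) + 2 ^ k - 1

/-- The function `f(x) = g(x) + (g(x) + x^d) (x + x^{2^k})^{2^n - 1}` with `n = 5k`, where `g` is
evaluated on the large field. Over a field with `2^n` elements the last factor is `0` on the
subfield with `2^k` elements and `1` elsewhere. -/
def modifiedDobbertin {L : Type*} [Field L] (k : ℕ) (g : L → L) (x : L) : L :=
  g x + (g x + x ^ dobbertinExp k) * (x + x ^ 2 ^ k) ^ (2 ^ (5 * k) - 1)

/-!
Write `N` for the norm from `L` to `K`, so that `x ^ d = N x / x ^ 2`, and consider the equation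
`(x + 1) ^ d + x ^ d = b`. If `b` lies in `K`, then clearing denominators gives a quadratic equation
for `x ^ 2` over `K`; as `L` has degree `5`, this forces `x` into `K`, where `x ^ d = x ^ 3`.

Let `b` be outside `K`. Choose `n` in `K` with `n ^ 4 = N (x + 1) / N x` and put
`t = n * x / (x + 1)`. Then `N t = n`, and `b` is the square of `β = c (n + n⁻¹ + t + t⁻¹)` for some
`c` in `K`. The conjugates of `t` together with `n⁻¹` are the roots of a sextic with constant
coefficient `1`. The elements `c (n + n⁻¹ + u + u⁻¹)`, for `u` among these roots, are the roots of
an explicit sextic over `K`, one of them being `0`; hence this sextic is `T` times the minimal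
polynomial of `β`, and depends only on `b`. Its shape allows one to recover `c` and `n`, so `b`
determines `t + t⁻¹`. Replacing `t` by `t⁻¹` replaces `x` by `x + 1`, so `x ↦ x ^ d` is APN.

Now let `f` agree with `g` on `K` and with `x ^ d` elsewhere. In a direction inside `K`, every
solution of the differential equation of `f` lies in `K` or every solution lies outside it. In a
direction `a` outside `K`, at most one solution `x` lies in `K` and at most one has `x + a` in `K`,
because the differential equations of `x ^ d` over `K` have no solutions outside `K`.
-/

open Polynomial

section Resolvent

variable {R : Type*} [CommRing R]

/-- The general shape of the degree six resolvent. It is quadratic in the cubic `H`, so that in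
characteristic `2` its derivative and its value at `B⁻¹` factor through `H`; see `sexticResolvent`
for the values of the parameters. -/
noncomputable def resolventForm (c φ B : R) (H : R[X]) : R[X] :=
  H ^ 2 + H * ((X + C φ) * (1 + C B * X)) + C (c ^ 2 * (1 + B * φ)) * (1 + C B * X) +
    C (c ^ 4 * B ^ 2)

theorem aeval_resolventForm {A : Type*} [CommRing A] [Algebra R A] (c φ B : R) (H : R[X]) (x : A) :
    aeval x (resolventForm c φ B H) = aeval x H ^ 2 +
      aeval x H * ((x + algebraMap R A φ) * (1 + algebraMap R A B * x)) +
      algebraMap R A c ^ 2 * (1 + algebraMap R A B * algebraMap R A φ) *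
        (1 + algebraMap R A B * x) +
      algebraMap R A c ^ 4 * algebraMap R A B ^ 2 := by
  simp [resolventForm]

theorem eq_cubic_of_monic {H : R[X]} (hH : H.Monic) (hdeg : H.natDegree = 3) :
    H = X ^ 3 + C (H.coeff 2) * X ^ 2 + C (H.coeff 1) * X + C (H.coeff 0) := by
  conv_lhs => rw [hH.as_sum, hdeg]
  simp only [Finset.sum_range_succ, Finset.sum_range_zero]
  ring

theorem mul_add_eq_zero_of_degree_lt [IsDomain R] {D A : R[X]}
    (h : (D * (D + A)).degree < A.degree) : D * (D + A) = 0 := by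
  by_contra hne
  obtain ⟨hD, hDA⟩ := mul_ne_zero_iff.1 hne
  have hA : A.degree ≤ max (D + A).degree D.degree := by
    simpa using degree_sub_le (D + A) D
  rw [degree_mul, degree_eq_natDegree hD, degree_eq_natDegree hDA] at h
  rw [degree_eq_natDegree hD, degree_eq_natDegree hDA] at hA
  refine (h.trans_le hA).not_ge (max_le ?_ ?_) <;> norm_cast <;> omega

variable [CharP R 2]

theorem resolventForm_cubic (c φ B h₂ h₁ h₀ : R) :
    resolventForm c φ B (X ^ 3 + C h₂ * X ^ 2 + C h₁ * X + C h₀) =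
      X ^ 6 + C B * X ^ 5 + C (h₂ ^ 2 + B * h₂ + (1 + B * φ)) * X ^ 4 +
      C (φ + (1 + B * φ) * h₂ + B * h₁) * X ^ 3 +
      C (h₁ ^ 2 + φ * h₂ + (1 + B * φ) * h₁ + B * h₀) * X ^ 2 +
      C (φ * h₁ + (1 + B * φ) * h₀ + c ^ 2 * B * (1 + B * φ)) * X +
      C (h₀ ^ 2 + φ * h₀ + c ^ 2 * (1 + B * φ) + c ^ 4 * B ^ 2) := by
  simp only [resolventForm, map_add, map_mul, map_pow, map_one]
  linear_combination (X ^ 5 * C h₂ + X ^ 4 * C h₁ + X ^ 3 * C h₀ + X ^ 3 * C h₂ * C h₁ +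
    X ^ 2 * C h₂ * C h₀ + X * C h₁ * C h₀) * (CharTwo.two_eq_zero : (2 : R[X]) = 0)

section Monic

variable (c φ B : R) {H : R[X]} (hH : H.Monic) (hdeg : H.natDegree = 3)
include hH hdeg

theorem monic_resolventForm : (resolventForm c φ B H).Monic := by
  rw [eq_cubic_of_monic hH hdeg, resolventForm_cubic]
  monicity!

theorem natDegree_resolventForm [Nontrivial R] : (resolventForm c φ B H).natDegree = 6 := by
  rw [eq_cubic_of_monic hH hdeg, resolventForm_cubic]
  compute_degree!

theorem coeff_five_resolventForm : (resolventForm c φ B H).coeff 5 = B := by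
  rw [eq_cubic_of_monic hH hdeg, resolventForm_cubic]
  simp [-map_add, -map_mul, -map_pow]

theorem coeff_four_resolventForm :
    (resolventForm c φ B H).coeff 4 = H.coeff 2 ^ 2 + B * H.coeff 2 + (1 + B * φ) := by
  rw [eq_cubic_of_monic hH hdeg, resolventForm_cubic]
  simp [-map_add, -map_mul, -map_pow]

theorem coeff_three_resolventForm :
    (resolventForm c φ B H).coeff 3 = φ + (1 + B * φ) * H.coeff 2 + B * H.coeff 1 := by
  rw [eq_cubic_of_monic hH hdeg, resolventForm_cubic]
  simp [-map_add, -map_mul, -map_pow, coeff_C]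

end Monic

theorem resolventForm_add_resolventForm (c c' φ B : R) (H H' : R[X]) :
    resolventForm c φ B H + resolventForm c' φ B H' =
      (H + H') * (H + H' + (X + C φ) * (1 + C B * X)) +
        (C ((c + c') ^ 2 * (1 + B * φ)) * (1 + C B * X) + C ((c + c') ^ 4 * B ^ 2)) := by
  simp only [resolventForm, CharTwo.add_sq, show 4 = 2 * 2 from rfl, pow_mul, map_add, map_mul]
  linear_combination (-H * H') * (CharTwo.two_eq_zero : (2 : R[X]) = 0)

end Resolvent

section ResolventField

variable {K : Type*} [Field K] [CharP K 2] {c c' φ φ' B B' : K} {H H' : K[X]}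

theorem eval_inv_resolventForm (hB : B ≠ 0) :
    (resolventForm c φ B H).eval B⁻¹ = (H.eval B⁻¹ + c ^ 2 * B) ^ 2 := by
  simp only [resolventForm, map_mul, map_pow, map_add, map_one, eval_add, eval_pow, eval_mul,
    eval_X, eval_C, eval_one, mul_inv_cancel₀ hB, CharTwo.add_self_eq_zero, CharTwo.add_sq]
  ring

theorem eval_inv_derivative_resolventForm (hB : B ≠ 0) :
    (derivative (resolventForm c φ B H)).eval B⁻¹ =
      (1 + B * φ) * (H.eval B⁻¹ + c ^ 2 * B) := by
  simp only [resolventForm, map_mul, map_pow, map_add, map_one, map_zero,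
    derivative_pow, derivative_mul, derivative_X, derivative_C, derivative_one, Nat.cast_ofNat,
    CharTwo.two_eq_zero, eval_add, eval_mul, eval_pow, eval_X, eval_C, eval_one, eval_zero,
    mul_inv_cancel₀ hB, CharTwo.add_self_eq_zero]
  field_simp
  ring

theorem resolventForm_phi_unique (hH : H.Monic) (hdeg : H.natDegree = 3)
    (hH' : H'.Monic) (hdeg' : H'.natDegree = 3)
    (hroot : B ≠ 0 → (resolventForm c φ B H).eval B⁻¹ ≠ 0)
    (h : resolventForm c φ B H = resolventForm c' φ' B H') : φ = φ' := by
  rcases eq_or_ne B 0 with rfl | hB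
  · have h₂ : H.coeff 2 = H'.coeff 2 := by
      have h₄ := congrArg (coeff · 4) h
      simpa [coeff_four_resolventForm, hH, hdeg, hH', hdeg', CharTwo.sq_inj] using h₄
    have h₃ := congrArg (coeff · 3) h
    simpa [coeff_three_resolventForm, hH, hdeg, hH', hdeg', h₂] using h₃
  · have hval : H.eval B⁻¹ + c ^ 2 * B = H'.eval B⁻¹ + c' ^ 2 * B := by
      have := congrArg (eval B⁻¹) h
      rwa [eval_inv_resolventForm hB, eval_inv_resolventForm hB, CharTwo.sq_inj] at this
    have hder := congrArg (fun P ↦ (derivative P).eval B⁻¹) h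
    simp only [eval_inv_derivative_resolventForm hB, hval] at hder
    have hne : H'.eval B⁻¹ + c' ^ 2 * B ≠ 0 := by
      rw [← hval]
      exact fun h0 ↦ hroot hB (by rw [eval_inv_resolventForm hB, h0, zero_pow two_ne_zero])
    exact mul_left_cancel₀ hB (add_left_cancel (mul_right_cancel₀ hne hder))

theorem resolventForm_scale_unique (h : resolventForm c φ B H = resolventForm c' φ B H') :
    c = c' := by
  set P : K[X] := 1 + C B * X with hP
  have hP0 : P ≠ 0 := fun h0 ↦ by simpa [hP] using congrArg (eval 0) h0
  set u : K := (c + c') ^ 2 * (1 + B * φ) with hu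
  have hprod : (H + H') * (H + H' + (X + C φ) * P) = C u * P + C ((c + c') ^ 4 * B ^ 2) := by
    rw [← CharTwo.add_eq_zero, ← resolventForm_add_resolventForm, h, CharTwo.add_self_eq_zero]
  have hdeg : (C u * P + C ((c + c') ^ 4 * B ^ 2)).degree < ((X + C φ) * P).degree := by
    have hle : (C u * P + C ((c + c') ^ 4 * B ^ 2)).degree ≤ P.degree :=
      (degree_add_le _ _).trans (max_le (smul_eq_C_mul (p := P) u ▸ degree_smul_le u P)
        (degree_C_le.trans (zero_le_degree_iff.2 hP0)))
    refine hle.trans_lt ?_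
    rw [degree_mul, degree_X_add_C, degree_eq_natDegree hP0]
    norm_cast
    omega
  have hzero := hprod.symm.trans (mul_add_eq_zero_of_degree_lt (hprod ▸ hdeg))
  have h₁ : u * B = 0 := by
    simpa [-map_add, -map_mul, -map_pow, hP, coeff_one, coeff_C] using congrArg (coeff · 1) hzero
  have h₀ : u + (c + c') ^ 4 * B ^ 2 = 0 := by
    simpa [-map_add, -map_mul, -map_pow, hP] using congrArg (coeff · 0) hzero
  rw [← CharTwo.add_eq_zero]
  rcases eq_or_ne B 0 with rfl | hB
  · simpa [hu] using h₀
  · rcases mul_eq_zero.1 h₁ with h₁ | h₁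
    · simpa [h₁, hB] using h₀
    · exact absurd h₁ hB

end ResolventField

section SexticResolvent

section CommRing

variable {R : Type*} [CommRing R]

/-- The cubic `G` attached to a monic sextic `S` with constant coefficient `1`: if `S` has the root
`t`, then in characteristic `2` the value of `G` at `w = t + t⁻¹` is linear in `t`, by
`aeval_reciprocalCubic`. -/
noncomputable def reciprocalCubic (S : R[X]) : R[X] :=
  X ^ 3 + C (S.coeff 1) * X ^ 2 + C (S.coeff 2 + 1) * X + C (S.coeff 3)

/-- The cubic `c³ G(s + T / c)` in `T`, where `G` is `reciprocalCubic S`. -/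
noncomputable def scaledCubic (c s : R) (S : R[X]) : R[X] :=
  (taylor s (reciprocalCubic S)).scaleRoots c

/-- A sextic in `T` with the root `c (s + t + t⁻¹)` for each root `t` of `S`, where `S` is a monic
sextic with constant coefficient `1`. The change of variable from `t + t⁻¹` to `T` normalises the
resolvent to the shape `resolventForm`, from which `c` and `s` can be read off. -/
noncomputable def sexticResolvent (c s : R) (S : R[X]) : R[X] :=
  resolventForm c (c * s) (c * (S.coeff 5 + S.coeff 1)) (scaledCubic c s S)

theorem monic_reciprocalCubic (S : R[X]) : (reciprocalCubic S).Monic := by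
  unfold reciprocalCubic; monicity!

theorem natDegree_reciprocalCubic [Nontrivial R] (S : R[X]) :
    (reciprocalCubic S).natDegree = 3 := by
  unfold reciprocalCubic; compute_degree!

theorem monic_scaledCubic (c s : R) (S : R[X]) : (scaledCubic c s S).Monic :=
  (monic_scaleRoots_iff c).2 ((leadingCoeff_taylor _ _).trans (monic_reciprocalCubic S))

theorem natDegree_scaledCubic [Nontrivial R] (c s : R) (S : R[X]) :
    (scaledCubic c s S).natDegree = 3 := by
  rw [scaledCubic, natDegree_scaleRoots, natDegree_taylor, natDegree_reciprocalCubic]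

variable {A : Type*} [CommRing A] [Algebra R A] [CharP A 2]

theorem aeval_scaledCubic [Nontrivial R] (c s : R) (S : R[X]) (w : A) :
    aeval (algebraMap R A c * (algebraMap R A s + w)) (scaledCubic c s S) =
      algebraMap R A c ^ 3 * aeval w (reciprocalCubic S) := by
  rw [scaledCubic, aeval_def, scaleRoots_eval₂_mul, natDegree_taylor, natDegree_reciprocalCubic,
    ← aeval_def, taylor_apply, aeval_comp, map_add, aeval_X, aeval_C, add_right_comm,
    CharTwo.add_self_eq_zero, zero_add]

theorem aeval_reciprocalCubic {S : R[X]} (hS : S.Monic) (hdeg : S.natDegree = 6)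
    (h0 : S.coeff 0 = 1) {t t' : A} (ht : t * t' = 1) (hroot : aeval t S = 0) :
    aeval (t + t') (reciprocalCubic S) =
      (algebraMap R A (S.coeff 5 + S.coeff 1) * (t + t') +
        algebraMap R A (S.coeff 4 + S.coeff 2)) * t + algebraMap R A (S.coeff 5 + S.coeff 1) := by
  have h6 : S.coeff 6 = 1 := hdeg ▸ hS
  rw [aeval_eq_sum_range, hdeg] at hroot
  simp only [Finset.sum_range_succ, Finset.sum_range_zero, Algebra.smul_def, h0, h6,
    map_one] at hroot
  simp only [reciprocalCubic, map_add, map_mul, map_pow, aeval_X, aeval_C, map_one]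
  grind

-- The left-hand side is the product of the two values of `G + (a * w + b) * x + a` at the roots
-- `x = t, t'` of `x ^ 2 + w * x + 1`, where `w = t + t'`.
theorem quadratic_eq_zero_of_eq_mul_add {R : Type*} [CommRing R] [CharP R 2]
    {G a b t t' : R} (ht : t * t' = 1) (h : G = (a * (t + t') + b) * t + a) :
    G ^ 2 + G * ((t + t') * (a * (t + t') + b)) + b * (a * (t + t') + b) + a ^ 2 = 0 := by
  grind

theorem aeval_sexticResolvent [Nontrivial R] {c s : R} {S : R[X]}
    (hc : c ^ 2 * ((S.coeff 5 + S.coeff 1) * s + (S.coeff 4 + S.coeff 2)) = 1)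
    (hS : S.Monic) (hdeg : S.natDegree = 6) (h0 : S.coeff 0 = 1)
    {t t' : A} (ht : t * t' = 1) (hroot : aeval t S = 0) :
    aeval (algebraMap R A c * (algebraMap R A s + (t + t'))) (sexticResolvent c s S) = 0 := by
  have hquad := quadratic_eq_zero_of_eq_mul_add ht (aeval_reciprocalCubic hS hdeg h0 ht hroot)
  have hc' := congrArg (algebraMap R A) hc
  rw [sexticResolvent, aeval_resolventForm, aeval_scaledCubic]
  simp only [map_mul, map_pow, map_one, map_add _ (_ * _) _] at hc' ⊢
  generalize algebraMap R A (S.coeff 5 + S.coeff 1) = a at *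
  generalize algebraMap R A (S.coeff 4 + S.coeff 2) = b at *
  generalize algebraMap R A c = γ, algebraMap R A s = σ at *
  have hX : γ * (σ + (t + t')) + γ * σ = γ * (t + t') := by
    linear_combination γ * σ * (CharTwo.two_eq_zero : (2 : A) = 0)
  have hBX : 1 + γ * a * (γ * (σ + (t + t'))) = γ ^ 2 * (a * (t + t') + b) := by grind
  have hBφ : 1 + γ * a * (γ * σ) = γ ^ 2 * b := by grind
  rw [hX, hBX, hBφ]
  linear_combination γ ^ 6 * hquad

end CommRing

section Field

variable {K : Type*} [Field K] [CharP K 2]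

theorem monic_sexticResolvent (c s : K) (S : K[X]) : (sexticResolvent c s S).Monic :=
  monic_resolventForm _ _ _ (monic_scaledCubic c s S) (natDegree_scaledCubic c s S)

theorem natDegree_sexticResolvent (c s : K) (S : K[X]) : (sexticResolvent c s S).natDegree = 6 :=
  natDegree_resolventForm _ _ _ (monic_scaledCubic c s S) (natDegree_scaledCubic c s S)

theorem sexticResolvent_parameters_unique {c c' s s' : K} {S S' : K[X]} (hc : c ≠ 0)
    (hroot : ∀ y ≠ 0, (sexticResolvent c s S).eval y ≠ 0)
    (h : sexticResolvent c s S = sexticResolvent c' s' S') : c = c' ∧ s = s' := by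
  have hH := monic_scaledCubic c s S
  have hdeg := natDegree_scaledCubic c s S
  have hH' := monic_scaledCubic c' s' S'
  have hdeg' := natDegree_scaledCubic c' s' S'
  unfold sexticResolvent at h hroot
  have hB := congrArg (coeff · 5) h
  simp only [coeff_five_resolventForm _ _ _ hH hdeg, coeff_five_resolventForm _ _ _ hH' hdeg'] at hB
  rw [← hB] at h
  have hφ := resolventForm_phi_unique hH hdeg hH' hdeg' (fun hB0 ↦ hroot _ (inv_ne_zero hB0)) h
  have hcc : c = c' := resolventForm_scale_unique (hφ ▸ h)
  subst hcc
  exact ⟨rfl, mul_left_cancel₀ hc hφ⟩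

end Field

end SexticResolvent

theorem eval_charpoly_lmul {R A : Type*} [CommRing R] [CommRing A] [Algebra R A]
    [Module.Free R A] [Module.Finite R A] (t : A) (u : R) :
    (Algebra.lmul R A t).charpoly.eval u = Algebra.norm R (algebraMap R A u - t) := by
  rw [LinearMap.eval_charpoly, Algebra.norm_apply, map_sub (Algebra.lmul R A), AlgHom.commutes]

theorem coeff_zero_charpoly_lmul {R A : Type*} [CommRing R] [CommRing A] [Algebra R A]
    [Module.Free R A] [Module.Finite R A] [CharP A 2] (t : A) :
    (Algebra.lmul R A t).charpoly.coeff 0 = Algebra.norm R t := by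
  rw [coeff_zero_eq_eval_zero, eval_charpoly_lmul, map_zero, zero_sub, CharTwo.neg_eq]

section PrimeDegree

variable {K L : Type*} [Field K] [Field L] [Algebra K L]

theorem natDegree_minpoly_of_prime_finrank [FiniteDimensional K L]
    (hp : (Module.finrank K L).Prime) {x : L} (hx : x ∉ Set.range (algebraMap K L)) :
    (minpoly K x).natDegree = Module.finrank K L :=
  ((Nat.dvd_prime hp).1 (minpoly.degree_dvd (Algebra.IsIntegral.isIntegral x))).resolve_left
    fun h ↦ hx (minpoly.natDegree_eq_one_iff.1 h)

theorem eval_minpoly_ne_zero [FiniteDimensional K L] {x : L}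
    (hx : x ∉ Set.range (algebraMap K L)) (u : K) : (minpoly K x).eval u ≠ 0 := by
  have hint : IsIntegral K x := Algebra.IsIntegral.isIntegral x
  exact fun hu ↦ hx <| minpoly.mem_range_of_degree_eq_one K x <|
    degree_eq_one_of_irreducible_of_root (minpoly.irreducible hint) hu

theorem eq_X_mul_minpoly {x : L} (hx : x ≠ 0) {P : K[X]} (hP : P.Monic)
    (hdeg : P.natDegree = (minpoly K x).natDegree + 1) (h0 : P.coeff 0 = 0) (hPx : aeval x P = 0) :
    P = X * minpoly K x := by
  obtain ⟨Q, rfl⟩ := X_dvd_iff.2 h0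
  have hQ : Q.Monic := monic_X.of_mul_monic_left hP
  have hQdeg : Q.natDegree = (minpoly K x).natDegree := by
    rwa [natDegree_X_mul hQ.ne_zero, Nat.add_right_cancel_iff] at hdeg
  have hQx : aeval x Q = 0 := by simpa [hx] using hPx
  rw [← minpoly.unique_of_degree_le_degree_minpoly K x hQ hQx (degree_le_degree ?_)]
  rw [hQdeg, coeff_natDegree]
  exact leadingCoeff_ne_zero.2 (minpoly.ne_zero ⟨Q, hQ, hQx⟩)

end PrimeDegree

section QuinticExtension

variable {K L : Type*} [Field K] [Field L] [Algebra K L]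

/-- The characteristic polynomial of `t`, completed by the root `(norm K t)⁻¹` to a polynomial whose
roots have product `1`. It is a sextic when `L` has degree `5` over `K`. -/
noncomputable def normSextic (K : Type*) {L : Type*} [Field K] [Field L] [Algebra K L]
    [FiniteDimensional K L] (t : L) : K[X] :=
  (X + C (Algebra.norm K t)⁻¹) * (Algebra.lmul K L t).charpoly

/-- `c` is the scale that normalises the resolvent of `normSextic K t`; see
`normSextic_coeff_relation`. -/
def IsResolventScale {K L : Type*} [Field K] [Field L] [Algebra K L] (c : K) (t : L) : Prop :=
  c ^ 2 * Algebra.norm K (algebraMap K L (Algebra.norm K t) + t) = Algebra.norm K t ^ 3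

/-- The root `c (n + n⁻¹ + t + t⁻¹)`, with `n = norm K t`, that `t` contributes to the resolvent
of `normSextic K t`. -/
noncomputable def resolventRoot {K L : Type*} [Field K] [Field L] [Algebra K L] (c : K) (t : L) :
    L :=
  algebraMap K L c *
    (algebraMap K L (Algebra.norm K t + (Algebra.norm K t)⁻¹) + (t + t⁻¹))

variable [FiniteDimensional K L]

theorem monic_normSextic (t : L) : (normSextic K t).Monic :=
  (monic_X_add_C _).mul (LinearMap.charpoly_monic _)

theorem natDegree_normSextic (h5 : Module.finrank K L = 5) (t : L) :
    (normSextic K t).natDegree = 6 := by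
  rw [normSextic, (monic_X_add_C _).natDegree_mul (LinearMap.charpoly_monic _),
    natDegree_X_add_C, LinearMap.charpoly_natDegree, h5]

theorem aeval_normSextic (t : L) : aeval t (normSextic K t) = 0 := by
  rw [normSextic, map_mul, Algebra.aeval_self_charpoly_lmul, mul_zero]

theorem coeff_zero_normSextic [CharP L 2] {t : L} (ht : t ≠ 0) : (normSextic K t).coeff 0 = 1 := by
  rw [normSextic, mul_coeff_zero, coeff_zero_charpoly_lmul]
  simp [Algebra.norm_ne_zero_iff.2 ht]

variable [CharP K 2]

theorem eval_inv_norm_normSextic (t : L) : (normSextic K t).eval (Algebra.norm K t)⁻¹ = 0 := by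
  rw [normSextic, eval_mul, eval_add, eval_X, eval_C, CharTwo.add_self_eq_zero, zero_mul]

theorem normSextic_coeff_relation [CharP L 2] (h5 : Module.finrank K L = 5) {c : K} {t : L}
    (ht : t ≠ 0) (hc : IsResolventScale c t) :
    c ^ 2 * (((normSextic K t).coeff 5 + (normSextic K t).coeff 1) *
        (Algebra.norm K t + (Algebra.norm K t)⁻¹) +
      ((normSextic K t).coeff 4 + (normSextic K t).coeff 2)) = 1 := by
  have hn : Algebra.norm K t ≠ 0 := Algebra.norm_ne_zero_iff.2 ht
  have h0 := coeff_zero_charpoly_lmul (R := K) t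
  rw [IsResolventScale, ← CharTwo.sub_eq_add, ← eval_charpoly_lmul] at hc
  have hdeg : (Algebra.lmul K L t).charpoly.natDegree = 5 := by
    rw [LinearMap.charpoly_natDegree, h5]
  have hlead : (Algebra.lmul K L t).charpoly.coeff 5 = 1 :=
    hdeg ▸ LinearMap.charpoly_monic (Algebra.lmul K L t)
  rw [eval_eq_sum_range, hdeg] at hc
  simp only [Finset.sum_range_succ, Finset.sum_range_zero, h0, hlead] at hc
  simp only [normSextic, add_mul, coeff_add, coeff_X_mul, coeff_C_mul, h0, hlead]
  generalize Algebra.norm K t = n at *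
  field_simp
  refine mul_left_cancel₀ hn ?_
  linear_combination hc + c ^ 2 * n ^ 2 * ((Algebra.lmul K L t).charpoly.coeff 4 + n +
    n * (Algebra.lmul K L t).charpoly.coeff 1) * (CharTwo.two_eq_zero : (2 : K) = 0)

theorem aeval_sexticResolvent_normSextic [CharP L 2] (h5 : Module.finrank K L = 5) {c : K} {t : L}
    (ht : t ≠ 0) (hc : IsResolventScale c t)
    {A : Type*} [CommRing A] [Algebra K A] [CharP A 2] {u u' : A} (hu : u * u' = 1)
    (hroot : aeval u (normSextic K t) = 0) :
    aeval (algebraMap K A c * (algebraMap K A (Algebra.norm K t + (Algebra.norm K t)⁻¹) +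
      (u + u'))) (sexticResolvent c (Algebra.norm K t + (Algebra.norm K t)⁻¹) (normSextic K t)) =
      0 :=
  aeval_sexticResolvent (normSextic_coeff_relation h5 ht hc) (monic_normSextic t)
    (natDegree_normSextic h5 t) (coeff_zero_normSextic ht) hu hroot

theorem sexticResolvent_normSextic [CharP L 2] (h5 : Module.finrank K L = 5) {c : K} {t : L}
    (ht : t ≠ 0) (hc : IsResolventScale c t)
    (hβ : resolventRoot c t ∉ Set.range (algebraMap K L)) :
    sexticResolvent c (Algebra.norm K t + (Algebra.norm K t)⁻¹) (normSextic K t) =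
      X * minpoly K (resolventRoot c t) := by
  refine eq_X_mul_minpoly (fun h0 ↦ hβ ⟨0, by rw [h0, map_zero]⟩) (monic_sexticResolvent _ _ _)
    ?_ ?_ (aeval_sexticResolvent_normSextic h5 ht hc (mul_inv_cancel₀ ht) (aeval_normSextic t))
  · rw [natDegree_sexticResolvent, natDegree_minpoly_of_prime_finrank (h5 ▸ Nat.prime_five) hβ, h5]
  · have h := aeval_sexticResolvent_normSextic h5 ht hc (A := K)
      (inv_mul_cancel₀ (Algebra.norm_ne_zero_iff.2 ht))
      (by rw [coe_aeval_eq_eval, eval_inv_norm_normSextic])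
    rwa [Algebra.algebraMap_self_apply, Algebra.algebraMap_self_apply,
      add_comm _ (Algebra.norm K t), CharTwo.add_self_eq_zero, mul_zero, coe_aeval_eq_eval,
      ← coeff_zero_eq_eval_zero] at h

end QuinticExtension

section NormRelation

theorem eq_or_eq_inv_of_add_inv_eq {F : Type*} [Field F] [CharP F 2] {u v : F} (hu : u ≠ 0)
    (hv : v ≠ 0) (h : u + u⁻¹ = v + v⁻¹) : v = u ∨ v = u⁻¹ := by
  have hprod : (v + u) * (v + u⁻¹) = 0 := by
    linear_combination (-v) * h + mul_inv_cancel₀ hu - mul_inv_cancel₀ hv +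
      (v * u + v * u⁻¹) * (CharTwo.two_eq_zero : (2 : F) = 0)
  exact (mul_eq_zero.1 hprod).imp CharTwo.add_eq_zero.1 CharTwo.add_eq_zero.1

theorem add_mul_add_one_eq_left {R : Type*} [CommRing R] [CharP R 2] {n t x : R}
    (h : t * (x + 1) = n * x) : (n + t) * (x + 1) = n := by
  linear_combination h + n * x * (CharTwo.two_eq_zero : (2 : R) = 0)

theorem add_ne_zero_of_mul_add_one_eq {R : Type*} [CommRing R] [CharP R 2] {n t x : R}
    (hn : n ≠ 0) (h : t * (x + 1) = n * x) : n + t ≠ 0 :=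
  left_ne_zero_of_mul (b := x + 1) ((add_mul_add_one_eq_left h).symm ▸ hn)

variable {K L : Type*} [Field K] [Field L] [Algebra K L] [FiniteDimensional K L]

theorem IsResolventScale.ne_zero {c : K} {t : L} (hc : IsResolventScale c t) (ht : t ≠ 0) :
    c ≠ 0 := by
  rintro rfl
  exact ht (by simpa [IsResolventScale] using hc.symm)

section Norm

variable {t x : L}

theorem algebraMap_norm_ne_zero (ht : t ≠ 0) : algebraMap K L (Algebra.norm K t) ≠ 0 := by
  simpa using ht

theorem norm_add_one_eq_norm_pow_mul (h5 : Module.finrank K L = 5) (ht : t ≠ 0)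
    (htx : t * (x + 1) = algebraMap K L (Algebra.norm K t) * x) :
    Algebra.norm K (x + 1) = Algebra.norm K t ^ 4 * Algebra.norm K x := by
  have h := congrArg (Algebra.norm K) htx
  rw [map_mul, map_mul, Algebra.norm_algebraMap, h5] at h
  exact mul_left_cancel₀ (Algebra.norm_ne_zero_iff.2 ht) (by linear_combination h)

theorem IsResolventScale.sq_mul_norm_sq [CharP L 2] (h5 : Module.finrank K L = 5) {c : K}
    (hc : IsResolventScale c t) (ht : t ≠ 0)
    (htx : t * (x + 1) = algebraMap K L (Algebra.norm K t) * x) :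
    c ^ 2 * Algebra.norm K t ^ 2 = Algebra.norm K (x + 1) := by
  have h := congrArg (Algebra.norm K) (add_mul_add_one_eq_left htx)
  rw [map_mul, Algebra.norm_algebraMap, h5] at h
  rw [IsResolventScale] at hc
  refine mul_left_cancel₀ (pow_ne_zero 3 (Algebra.norm_ne_zero_iff.2 ht)) ?_
  linear_combination (-c ^ 2) * h + Algebra.norm K (x + 1) * hc

theorem resolventRoot_sq [CharP L 2] (h5 : Module.finrank K L = 5) {c : K} (ht : t ≠ 0)
    (hx0 : x ≠ 0) (hx1 : x + 1 ≠ 0) (hc : IsResolventScale c t)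
    (htx : t * (x + 1) = algebraMap K L (Algebra.norm K t) * x) :
    resolventRoot c t ^ 2 = algebraMap K L (Algebra.norm K (x + 1)) / (x + 1) ^ 2 +
      algebraMap K L (Algebra.norm K x) / x ^ 2 := by
  have hM := congrArg (algebraMap K L) (hc.sq_mul_norm_sq h5 ht htx)
  have hN := congrArg (algebraMap K L) (norm_add_one_eq_norm_pow_mul h5 ht htx)
  have hn := algebraMap_norm_ne_zero (K := K) ht
  have hsum := add_mul_add_one_eq_left htx
  rw [resolventRoot, map_add, map_inv₀]
  simp only [map_mul, map_pow] at hM hN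
  generalize algebraMap K L (Algebra.norm K t) = n at *
  have hadd : n + t = n / (x + 1) := (eq_div_iff hx1).2 hsum
  have hadd_inv : n⁻¹ + t⁻¹ = n⁻¹ / x := by
    field_simp
    linear_combination t * x * (CharTwo.two_eq_zero : (2 : L) = 0) - htx
  rw [add_add_add_comm, hadd, hadd_inv, mul_pow, CharTwo.add_sq, ← hM]
  have hN' : algebraMap K L (Algebra.norm K x) = algebraMap K L c ^ 2 * n⁻¹ ^ 2 := by
    field_simp
    refine mul_left_cancel₀ (pow_ne_zero 2 hn) ?_
    linear_combination -hN - hM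
  simp only [hN', div_eq_mul_inv, mul_pow, inv_pow]
  ring

end Norm

variable [CharP K 2]

theorem exists_mul_add_one_eq_norm_mul [PerfectRing K 2] (h5 : Module.finrank K L = 5)
    {x : L} (hx0 : x ≠ 0) (hx1 : x + 1 ≠ 0) :
    ∃ t : L, t ≠ 0 ∧ t * (x + 1) = algebraMap K L (Algebra.norm K t) * x := by
  have hN : Algebra.norm K x ≠ 0 := Algebra.norm_ne_zero_iff.2 hx0
  have hM : Algebra.norm K (x + 1) ≠ 0 := Algebra.norm_ne_zero_iff.2 hx1
  obtain ⟨n, hn⟩ : ∃ n : K, n ^ 4 * Algebra.norm K x = Algebra.norm K (x + 1) := by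
    obtain ⟨m, hm⟩ := surjective_frobenius K 2 (Algebra.norm K (x + 1) / Algebra.norm K x)
    obtain ⟨n, rfl⟩ := surjective_frobenius K 2 m
    refine ⟨n, (eq_div_iff hN).1 ?_⟩
    rw [← hm, frobenius_def, frobenius_def, ← pow_mul]
  have hn0 : n ≠ 0 := by
    rintro rfl
    exact hM (by rw [← hn, zero_pow four_ne_zero, zero_mul])
  have htx : algebraMap K L n * x / (x + 1) * (x + 1) = algebraMap K L n * x :=
    div_mul_cancel₀ _ hx1
  have hnorm : Algebra.norm K (algebraMap K L n * x / (x + 1)) = n := by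
    have h := congrArg (Algebra.norm K) htx
    rw [map_mul, map_mul, Algebra.norm_algebraMap, h5, ← hn] at h
    exact mul_right_cancel₀ (mul_ne_zero (pow_ne_zero 4 hn0) hN) (by linear_combination h)
  have hnL : algebraMap K L n ≠ 0 := by simpa using hn0
  exact ⟨_, div_ne_zero (mul_ne_zero hnL hx0) hx1, by rw [hnorm, htx]⟩

theorem exists_isResolventScale [PerfectRing K 2] {t : L}
    (ht : algebraMap K L (Algebra.norm K t) + t ≠ 0) : ∃ c : K, IsResolventScale c t := by
  obtain ⟨c, hc⟩ := surjective_frobenius K 2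
    (Algebra.norm K t ^ 3 / Algebra.norm K (algebraMap K L (Algebra.norm K t) + t))
  exact ⟨c, (eq_div_iff (Algebra.norm_ne_zero_iff.2 ht)).1 hc⟩

variable [CharP L 2]

theorem eq_or_eq_inv_of_resolventRoot_eq (h5 : Module.finrank K L = 5) {c c' : K} {t t' : L}
    (ht : t ≠ 0) (ht' : t' ≠ 0) (hc : IsResolventScale c t) (hc' : IsResolventScale c' t')
    (hK : resolventRoot c t ∉ Set.range (algebraMap K L))
    (h : resolventRoot c t = resolventRoot c' t') : t' = t ∨ t' = t⁻¹ := by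
  have hR := sexticResolvent_normSextic h5 ht hc hK
  have hR' := sexticResolvent_normSextic h5 ht' hc' (h ▸ hK)
  have hroot (y : K) (hy : y ≠ 0) : (X * minpoly K (resolventRoot c t)).eval y ≠ 0 := by
    simpa [hy] using eval_minpoly_ne_zero hK y
  obtain ⟨rfl, hs⟩ := sexticResolvent_parameters_unique (hc.ne_zero ht) (hR ▸ hroot)
    (hR.trans (h ▸ hR'.symm))
  have hc0 : algebraMap K L c ≠ 0 := by simpa using hc.ne_zero ht
  rw [resolventRoot, resolventRoot, hs] at h
  exact eq_or_eq_inv_of_add_inv_eq ht ht' (add_left_cancel (mul_left_cancel₀ hc0 h))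

theorem eq_or_eq_add_one_of_norm_div_sq_eq [PerfectRing K 2] (h5 : Module.finrank K L = 5)
    {b x y : L} (hb : b ∉ Set.range (algebraMap K L))
    (hx0 : x ≠ 0) (hx1 : x + 1 ≠ 0) (hy0 : y ≠ 0) (hy1 : y + 1 ≠ 0)
    (hx : algebraMap K L (Algebra.norm K (x + 1)) / (x + 1) ^ 2 +
      algebraMap K L (Algebra.norm K x) / x ^ 2 = b)
    (hy : algebraMap K L (Algebra.norm K (y + 1)) / (y + 1) ^ 2 +
      algebraMap K L (Algebra.norm K y) / y ^ 2 = b) : y = x ∨ y = x + 1 := by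
  obtain ⟨t, ht, htx⟩ := exists_mul_add_one_eq_norm_mul h5 hx0 hx1
  obtain ⟨t', ht', hty⟩ := exists_mul_add_one_eq_norm_mul h5 hy0 hy1
  have hnt := add_ne_zero_of_mul_add_one_eq (algebraMap_norm_ne_zero ht) htx
  obtain ⟨c, hc⟩ := exists_isResolventScale hnt
  obtain ⟨c', hc'⟩ := exists_isResolventScale
    (add_ne_zero_of_mul_add_one_eq (algebraMap_norm_ne_zero ht') hty)
  have hβ : resolventRoot c t ^ 2 = b := (resolventRoot_sq h5 ht hx0 hx1 hc htx).trans hx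
  have hβ' : resolventRoot c' t' ^ 2 = b := (resolventRoot_sq h5 ht' hy0 hy1 hc' hty).trans hy
  have hK : resolventRoot c t ∉ Set.range (algebraMap K L) := by
    rintro ⟨u, hu⟩
    exact hb ⟨u ^ 2, by rw [map_pow, hu, hβ]⟩
  have hxn := add_mul_add_one_eq_left htx
  rcases eq_or_eq_inv_of_resolventRoot_eq h5 ht ht' hc hc' hK
    (CharTwo.sq_injective (hβ.trans hβ'.symm)) with rfl | rfl
  · left
    refine add_right_cancel (b := (1 : L)) (mul_left_cancel₀ hnt ?_)
    rw [hxn, add_mul_add_one_eq_left hty]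
  · right
    have hinv : algebraMap K L (Algebra.norm K t) * algebraMap K L (Algebra.norm K t⁻¹) = 1 := by
      rw [← map_mul, ← map_mul, mul_inv_cancel₀ ht, map_one, map_one]
    generalize algebraMap K L (Algebra.norm K t) = n at *
    have hyn : n * (y + 1) = t * y := by
      linear_combination n * t * hty + t * y * hinv - n * (y + 1) * mul_inv_cancel₀ ht
    refine mul_left_cancel₀ hnt ?_
    linear_combination hyn - hxn + (t * y - n) * (CharTwo.two_eq_zero : (2 : L) = 0)

end NormRelation

section PerfectField

variable {K L : Type*} [Field K] [Field L] [Algebra K L] [CharP K 2] [CharP L 2] [PerfectRing K 2]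

theorem mem_range_of_sq_mem_range {x : L} (h : x ^ 2 ∈ Set.range (algebraMap K L)) :
    x ∈ Set.range (algebraMap K L) := by
  obtain ⟨u, hu⟩ := h
  obtain ⟨v, rfl⟩ := surjective_frobenius K 2 u
  exact ⟨v, CharTwo.sq_inj.1 (by rw [← hu, frobenius_def, map_pow])⟩

theorem mem_range_of_norm_div_sq_eq [FiniteDimensional K L]
    (hp : (Module.finrank K L).Prime) (h2 : 2 < Module.finrank K L) {a b : K} (ha : a ≠ 0) {x : L}
    (h : algebraMap K L (Algebra.norm K (x + algebraMap K L a)) / (x + algebraMap K L a) ^ 2 +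
      algebraMap K L (Algebra.norm K x) / x ^ 2 = algebraMap K L b) :
    x ∈ Set.range (algebraMap K L) := by
  by_contra hx
  have hx0 : x ≠ 0 := fun h0 ↦ hx ⟨0, by rw [h0, map_zero]⟩
  have hxa : x + algebraMap K L a ≠ 0 := fun h0 ↦ hx ⟨a, (CharTwo.add_eq_zero.1 h0).symm⟩
  set P : K[X] := C b * X ^ 2 +
    C (b * a ^ 2 + Algebra.norm K (x + algebraMap K L a) + Algebra.norm K x) * X +
    C (Algebra.norm K x * a ^ 2) with hP
  have hPx : aeval (x ^ 2) P = 0 := by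
    field_simp at h
    simp only [hP, map_add, map_mul, map_pow, aeval_X, aeval_C]
    rw [CharTwo.add_sq] at h
    linear_combination h + (algebraMap K L b * x ^ 2 * (x ^ 2 + algebraMap K L a ^ 2)) *
      (CharTwo.two_eq_zero : (2 : L) = 0)
  have hdeg : P.degree < (minpoly K (x ^ 2)).degree := by
    rw [degree_eq_natDegree (minpoly.ne_zero_of_finite K (x ^ 2)),
      natDegree_minpoly_of_prime_finrank hp (mt mem_range_of_sq_mem_range hx)]
    exact degree_quadratic_le.trans_lt (by exact_mod_cast h2)
  have hP0 : P = 0 := by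
    by_contra hne
    exact (minpoly.degree_le_of_ne_zero K _ hne hPx).not_gt hdeg
  have hcoeff : Algebra.norm K x * a ^ 2 = 0 := by
    simpa [-map_add, -map_mul, -map_pow, hP] using congrArg (coeff · 0) hP0
  exact mul_ne_zero (Algebra.norm_ne_zero_iff.2 hx0) (pow_ne_zero 2 ha) hcoeff

end PerfectField

section FiniteField

theorem pow_injective_of_coprime {F : Type*} [Field F] {m : ℕ} (hm : m ≠ 0)
    (h : (Nat.card F - 1).Coprime m) : Function.Injective fun x : F ↦ x ^ m := by
  intro x y (hxy : x ^ m = y ^ m)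
  rcases eq_or_ne y 0 with rfl | hy
  · rwa [zero_pow hm, pow_eq_zero_iff hm] at hxy
  have hx : x ≠ 0 := by
    rintro rfl
    exact pow_ne_zero m hy (by rw [← hxy, zero_pow hm])
  rw [← Nat.card_units] at h
  have hunits : Units.mk0 x hx ^ m = Units.mk0 y hy ^ m := Units.ext hxy
  exact congrArg Units.val ((powCoprime h).injective hunits)

theorem coprime_two_pow_sub_one_three {k : ℕ} (hk : Odd k) : (2 ^ k - 1).Coprime 3 := by
  obtain ⟨j, rfl⟩ := hk
  have hmod : 2 ^ (2 * j + 1) % 3 = 2 := by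
    rw [pow_succ, pow_mul, Nat.mul_mod, Nat.pow_mod]
    simp
  rw [Nat.coprime_comm, Nat.Prime.coprime_iff_not_dvd Nat.prime_three]
  generalize 2 ^ (2 * j + 1) = q at *
  omega

theorem mem_range_of_pow_card_eq {K L : Type*} [Field K] [Fintype K] [Field L] [Algebra K L]
    {x : L} (hx : x ^ Fintype.card K = x) : x ∈ Set.range (algebraMap K L) := by
  have hsplits : (X ^ Fintype.card K - X : K[X]).Splits := by
    simpa using (FiniteField.isSplittingField_sub K K).splits
  refine hsplits.mem_range_of_isRoot (FiniteField.X_pow_card_sub_X_ne_zero K Fintype.one_lt_card) ?_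
  simp [IsRoot, hx]

end FiniteField

section DobbertinPower

theorem dobbertinExp_add_two (k : ℕ) :
    dobbertinExp k + 2 = ∑ i ∈ Finset.range 5, (2 ^ k) ^ i := by
  have hpos : 1 ≤ 2 ^ (4 * k) + 2 ^ (3 * k) + 2 ^ (2 * k) + 2 ^ k :=
    Nat.one_le_two_pow.trans (Nat.le_add_left _ _)
  simp only [dobbertinExp, Finset.sum_range_succ, Finset.sum_range_zero, ← pow_mul', zero_mul,
    one_mul, pow_zero]
  omega

theorem dobbertinExp_ne_zero (k : ℕ) : dobbertinExp k ≠ 0 := by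
  have hpos : 0 < 2 ^ (4 * k) + 2 ^ (3 * k) + 2 ^ (2 * k) := by positivity
  have hk : 0 < 2 ^ k := by positivity
  exact Nat.sub_ne_zero_of_lt (by linarith)

theorem pow_add_add_pow_eq {F : Type*} [Field F] {a : F} (ha : a ≠ 0) (x : F) (d : ℕ) :
    (x + a) ^ d + x ^ d = a ^ d * ((x / a + 1) ^ d + (x / a) ^ d) := by
  rw [mul_add, ← mul_pow, ← mul_pow, mul_add, mul_div_cancel₀ _ ha, mul_one]

theorem eq_or_eq_add_one_of_cube_derivative_eq {R : Type*} [CommRing R] [IsDomain R] [CharP R 2]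
    {x y : R} (h : (x + 1) ^ 3 + x ^ 3 = (y + 1) ^ 3 + y ^ 3) : y = x ∨ y = x + 1 := by
  have hprod : (y + x) * (y + (x + 1)) = 0 := by
    linear_combination (norm := grind) h
  exact (mul_eq_zero.1 hprod).imp CharTwo.add_eq_zero.1 CharTwo.add_eq_zero.1

variable {K L : Type*} [Field K] [Field L] [Finite L] [Algebra K L] {k : ℕ}
  (hK : Nat.card K = 2 ^ k) (h5 : Module.finrank K L = 5)
include hK h5

theorem pow_dobbertinExp_eq_norm_div_sq (x : L) :
    x ^ dobbertinExp k = algebraMap K L (Algebra.norm K x) / x ^ 2 := by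
  rcases eq_or_ne x 0 with rfl | hx
  · simp [dobbertinExp_ne_zero]
  rw [eq_div_iff (pow_ne_zero 2 hx), ← pow_add, dobbertinExp_add_two,
    FiniteField.algebraMap_norm_eq_prod_pow, h5, hK, Finset.prod_pow_eq_pow_sum]

theorem pow_dobbertinExp_algebraMap (u : K) :
    algebraMap K L u ^ dobbertinExp k = algebraMap K L u ^ 3 := by
  rcases eq_or_ne u 0 with rfl | hu
  · simp [dobbertinExp_ne_zero]
  have hu' : algebraMap K L u ≠ 0 := by simpa using hu
  rw [pow_dobbertinExp_eq_norm_div_sq hK h5, Algebra.norm_algebraMap, h5, map_pow,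
    div_eq_iff (pow_ne_zero 2 hu'), ← pow_add]

theorem norm_pow_dobbertinExp (x : L) :
    Algebra.norm K (x ^ dobbertinExp k) = Algebra.norm K x ^ 3 := by
  rw [map_pow]
  exact (algebraMap K L).injective (by rw [map_pow, map_pow, pow_dobbertinExp_algebraMap hK h5])

variable [CharP L 2]

theorem pow_dobbertinExp_injective (hk : Odd k) :
    Function.Injective fun x : L ↦ x ^ dobbertinExp k := by
  intro x y (h : x ^ dobbertinExp k = y ^ dobbertinExp k)
  have hN : Algebra.norm K x = Algebra.norm K y := by
    apply pow_injective_of_coprime three_ne_zero (hK ▸ coprime_two_pow_sub_one_three hk)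
    simpa only [norm_pow_dobbertinExp hK h5] using congrArg (Algebra.norm K) h
  rcases eq_or_ne x 0 with rfl | hx
  · rw [zero_pow (dobbertinExp_ne_zero k)] at h
    exact (pow_eq_zero_iff (dobbertinExp_ne_zero k) |>.1 h.symm).symm
  rw [pow_dobbertinExp_eq_norm_div_sq hK h5, pow_dobbertinExp_eq_norm_div_sq hK h5, ← hN,
    div_eq_div_iff_comm, div_left_inj' (algebraMap_norm_ne_zero hx)] at h
  exact CharTwo.sq_injective h

variable [CharP K 2] [Finite K]

theorem mem_range_of_pow_dobbertinExp_mem_range {x : L}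
    (h : x ^ dobbertinExp k ∈ Set.range (algebraMap K L)) : x ∈ Set.range (algebraMap K L) := by
  obtain ⟨u, hu⟩ := h
  rcases eq_or_ne x 0 with rfl | hx
  · exact ⟨0, map_zero _⟩
  refine mem_range_of_sq_mem_range ⟨Algebra.norm K x / u, ?_⟩
  rw [map_div₀, hu, pow_dobbertinExp_eq_norm_div_sq hK h5,
    div_div_cancel₀ (algebraMap_norm_ne_zero hx)]

theorem mem_range_of_derivative_pow_dobbertinExp_eq {a b : K} (ha : a ≠ 0) {x : L}
    (h : (x + algebraMap K L a) ^ dobbertinExp k + x ^ dobbertinExp k = algebraMap K L b) :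
    x ∈ Set.range (algebraMap K L) := by
  rw [pow_dobbertinExp_eq_norm_div_sq hK h5, pow_dobbertinExp_eq_norm_div_sq hK h5] at h
  exact mem_range_of_norm_div_sq_eq (h5 ▸ Nat.prime_five) (by rw [h5]; norm_num) ha h

theorem eq_or_eq_add_one_of_derivative_pow_dobbertinExp_eq {x y : L}
    (h : (x + 1) ^ dobbertinExp k + x ^ dobbertinExp k =
      (y + 1) ^ dobbertinExp k + y ^ dobbertinExp k) : y = x ∨ y = x + 1 := by
  by_cases hb : (x + 1) ^ dobbertinExp k + x ^ dobbertinExp k ∈ Set.range (algebraMap K L)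
  · obtain ⟨b, hb⟩ := hb
    have hmem (z : L) (hz : (z + 1) ^ dobbertinExp k + z ^ dobbertinExp k = algebraMap K L b) :
        z ∈ Set.range (algebraMap K L) :=
      mem_range_of_derivative_pow_dobbertinExp_eq hK h5 one_ne_zero
        (by simpa only [map_one] using hz)
    obtain ⟨u, rfl⟩ := hmem x hb.symm
    obtain ⟨v, rfl⟩ := hmem y (h ▸ hb.symm)
    have hcube (w : K) : (algebraMap K L w + 1) ^ dobbertinExp k = (algebraMap K L w + 1) ^ 3 := by
      simpa using pow_dobbertinExp_algebraMap hK h5 (w + 1)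
    rw [hcube, hcube, pow_dobbertinExp_algebraMap hK h5, pow_dobbertinExp_algebraMap hK h5] at h
    exact eq_or_eq_add_one_of_cube_derivative_eq h
  · have hne (z : L)
        (hz : (z + 1) ^ dobbertinExp k + z ^ dobbertinExp k ∉ Set.range (algebraMap K L)) :
        z ≠ 0 ∧ z + 1 ≠ 0 := by
      constructor
      · rintro rfl
        exact hz ⟨1, by simp [dobbertinExp_ne_zero]⟩
      · intro h0
        rw [h0, CharTwo.add_eq_zero.1 h0] at hz
        exact hz ⟨1, by simp [dobbertinExp_ne_zero]⟩
    obtain ⟨hx0, hx1⟩ := hne x hb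
    obtain ⟨hy0, hy1⟩ := hne y (h ▸ hb)
    simp only [pow_dobbertinExp_eq_norm_div_sq hK h5] at h hb
    exact eq_or_eq_add_one_of_norm_div_sq_eq h5 hb hx0 hx1 hy0 hy1 rfl h.symm

theorem eq_or_eq_add_of_derivative_pow_dobbertinExp_eq {a x y : L} (ha : a ≠ 0)
    (h : (x + a) ^ dobbertinExp k + x ^ dobbertinExp k =
      (y + a) ^ dobbertinExp k + y ^ dobbertinExp k) : y = x ∨ y = x + a := by
  rw [pow_add_add_pow_eq ha, pow_add_add_pow_eq ha] at h
  have hone := eq_or_eq_add_one_of_derivative_pow_dobbertinExp_eq hK h5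
    (mul_left_cancel₀ (pow_ne_zero _ ha) h)
  rwa [div_add_one ha, div_left_inj' ha, div_left_inj' ha] at hone

end DobbertinPower

section DifferentialUniformity

theorem diffCount_le_diffUniformity {F : Type*} [Field F] [Fintype F] (f : F → F) {a : F}
    (ha : a ≠ 0) (b : F) : diffCount f a b ≤ diffUniformity f := by
  classical
  exact Finset.le_sup (f := fun p : F × F ↦ diffCount f p.1 p.2) (b := (a, b)) (by simpa using ha)

theorem diffUniformity_le {F : Type*} [Field F] [Fintype F] {f : F → F} {m : ℕ}
    (h : ∀ a b, a ≠ 0 → diffCount f a b ≤ m) : diffUniformity f ≤ m := by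
  classical
  exact Finset.sup_le fun p hp ↦ h p.1 p.2 (by simpa using hp)

theorem diffUniformity_le_two {F : Type*} [Field F] [Fintype F] {f : F → F}
    (h : ∀ a x y, a ≠ 0 → f (x + a) + f x = f (y + a) + f y → y = x ∨ y = x + a) :
    diffUniformity f ≤ 2 := by
  refine diffUniformity_le fun a b ha ↦ ?_
  unfold diffCount
  rcases Set.eq_empty_or_nonempty {x | f (x + a) + f x = b} with hS | ⟨x, hx⟩
  · simp [hS]
  · have hsub : {y | f (y + a) + f y = b} ⊆ {x, x + a} := fun y hy ↦ h a x y ha (hx.trans hy.symm)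
    exact (Set.ncard_le_ncard hsub).trans (by
      simpa using Set.ncard_insert_le x {x + a})

theorem add_mem_range_iff {K L : Type*} [Ring K] [Ring L] {φ : K →+* L} {x y : L}
    (hy : y ∈ Set.range φ) : x + y ∈ Set.range φ ↔ x ∈ Set.range φ :=
  add_mem_cancel_right (H := φ.range) hy

variable {K L : Type*} [Field K] [Field L] [Algebra K L] {g : K → K} {f p : L → L}
  (hfg : ∀ u, f (algebraMap K L u) = algebraMap K L (g u))
include hfg

theorem diffUniformity_le_of_extends [Fintype K] [Fintype L] :
    diffUniformity g ≤ diffUniformity f := by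
  refine diffUniformity_le fun a b ha ↦ ?_
  refine le_trans ?_ (diffCount_le_diffUniformity f (a := algebraMap K L a) (by simpa using ha)
    (algebraMap K L b))
  refine Set.ncard_le_ncard_of_injOn (algebraMap K L) (fun u hu ↦ ?_)
    (algebraMap K L).injective.injOn
  have hu : g (u + a) + g u = b := hu
  change f (algebraMap K L u + algebraMap K L a) + f (algebraMap K L u) = algebraMap K L b
  rw [← map_add, hfg, hfg, ← map_add, hu]

variable (hfp : ∀ x, x ∉ Set.range (algebraMap K L) → f x = p x)
include hfp

theorem bijective_of_extends [Finite L] (hg : Function.Injective g) (hp : Function.Injective p)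
    (hpK : ∀ x, p x ∈ Set.range (algebraMap K L) → x ∈ Set.range (algebraMap K L)) :
    Function.Bijective f := by
  have hmem (x : L) : f x ∈ Set.range (algebraMap K L) ↔ x ∈ Set.range (algebraMap K L) := by
    refine ⟨fun h ↦ by_contra fun hx ↦ hx (hpK x (hfp x hx ▸ h)), ?_⟩
    rintro ⟨u, rfl⟩
    exact ⟨g u, (hfg u).symm⟩
  refine Finite.injective_iff_bijective.1 fun x y hxy ↦ ?_
  have hiff : x ∈ Set.range (algebraMap K L) ↔ y ∈ Set.range (algebraMap K L) := by
    rw [← hmem, hxy, hmem]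
  by_cases hx : x ∈ Set.range (algebraMap K L)
  · obtain ⟨⟨u, rfl⟩, ⟨v, rfl⟩⟩ := And.intro hx (hiff.1 hx)
    rw [hfg, hfg] at hxy
    rw [hg ((algebraMap K L).injective hxy)]
  · rw [hfp x hx, hfp y (mt hiff.2 hx)] at hxy
    exact hp hxy

theorem diffCount_algebraMap_le_of_notMem_range [Finite L] (a : K) {b : L}
    (hb : b ∉ Set.range (algebraMap K L)) :
    diffCount f (algebraMap K L a) b ≤ diffCount p (algebraMap K L a) b := by
  refine Set.ncard_le_ncard fun x (hx : f (x + algebraMap K L a) + f x = b) ↦ ?_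
  have hxK : x ∉ Set.range (algebraMap K L) := by
    rintro ⟨u, rfl⟩
    rw [← map_add, hfg, hfg, ← map_add] at hx
    exact hb ⟨_, hx⟩
  rwa [hfp x hxK, hfp _ (mt (add_mem_range_iff ⟨a, rfl⟩).1 hxK)] at hx

variable (hp : ∀ a b : K, a ≠ 0 → ∀ x : L,
  p (x + algebraMap K L a) + p x = algebraMap K L b → x ∈ Set.range (algebraMap K L))
include hp

theorem diffCount_algebraMap_le [Finite K] {a : K} (ha : a ≠ 0) (b : K) :
    diffCount f (algebraMap K L a) (algebraMap K L b) ≤ diffCount g a b := by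
  have hsub : {x | f (x + algebraMap K L a) + f x = algebraMap K L b} ⊆
      algebraMap K L '' {u | g (u + a) + g u = b} := by
    intro x (hx : f (x + algebraMap K L a) + f x = algebraMap K L b)
    have hxK : x ∈ Set.range (algebraMap K L) := by
      by_contra hxK
      rw [hfp x hxK, hfp _ (mt (add_mem_range_iff ⟨a, rfl⟩).1 hxK)] at hx
      exact hxK (hp a b ha x hx)
    obtain ⟨u, rfl⟩ := hxK
    rw [← map_add, hfg, hfg, ← map_add] at hx
    exact ⟨u, (algebraMap K L).injective hx, rfl⟩
  exact (Set.ncard_le_ncard hsub).trans Set.ncard_image_le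

variable [CharP L 2]

theorem subsingleton_algebraMap_solutions {a : L} (ha : a ∉ Set.range (algebraMap K L)) (b : L) :
    {u : K | f (algebraMap K L u + a) + f (algebraMap K L u) = b}.Subsingleton := by
  intro u hu v hv
  have hshift (w : K) : algebraMap K L w + a ∉ Set.range (algebraMap K L) := by
    rwa [add_comm, add_mem_range_iff ⟨w, rfl⟩]
  have hderiv (w : K) (hw : f (algebraMap K L w + a) + f (algebraMap K L w) = b) :
      p (algebraMap K L w + a) + algebraMap K L (g w) = b := by
    rwa [← hfp _ (hshift w), ← hfg]
  by_contra hne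
  refine hshift v (hp (u - v) (g u + g v) (sub_ne_zero.2 hne) _ ?_)
  rw [map_sub, map_add, show algebraMap K L v + a + (algebraMap K L u - algebraMap K L v) =
    algebraMap K L u + a by ring]
  linear_combination hderiv u hu - hderiv v hv + (p (algebraMap K L v + a) -
    algebraMap K L (g u)) * (CharTwo.two_eq_zero : (2 : L) = 0)

theorem diffCount_le_add_two [Finite K] [Finite L] {a : L}
    (ha : a ∉ Set.range (algebraMap K L)) (b : L) : diffCount f a b ≤ diffCount p a b + 2 := by
  set T : Set K := {u | f (algebraMap K L u + a) + f (algebraMap K L u) = b}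
  have hT : T.ncard ≤ 1 := Set.ncard_le_one_iff_subsingleton.2
    (subsingleton_algebraMap_solutions hfg hfp hp ha b)
  have hsub : {x | f (x + a) + f x = b} ⊆ {x | p (x + a) + p x = b} ∪
      (algebraMap K L '' T ∪ (fun u ↦ algebraMap K L u + a) '' T) := by
    intro x (hx : f (x + a) + f x = b)
    by_cases hxK : x ∈ Set.range (algebraMap K L)
    · obtain ⟨u, rfl⟩ := hxK
      exact Or.inr (Or.inl ⟨u, hx, rfl⟩)
    by_cases hxa : x + a ∈ Set.range (algebraMap K L)
    · obtain ⟨u, hu⟩ := hxa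
      have hxu : algebraMap K L u + a = x := by
        rw [hu, add_assoc, CharTwo.add_self_eq_zero, add_zero]
      refine Or.inr (Or.inr ⟨u, ?_, hxu⟩)
      change f (algebraMap K L u + a) + f (algebraMap K L u) = b
      rwa [hxu, hu, add_comm]
    · exact Or.inl (by rwa [hfp x hxK, hfp _ hxa] at hx)
  calc diffCount f a b
      ≤ diffCount p a b + ((algebraMap K L '' T).ncard +
        ((fun u ↦ algebraMap K L u + a) '' T).ncard) :=
        (Set.ncard_le_ncard hsub).trans <| (Set.ncard_union_le _ _).trans <|
          Nat.add_le_add_left (Set.ncard_union_le _ _) _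
    _ ≤ diffCount p a b + (1 + 1) := by
        gcongr <;> exact (Set.ncard_image_le (Set.toFinite T)).trans hT

theorem diffUniformity_le_max [Fintype K] [Fintype L] :
    diffUniformity f ≤ max (diffUniformity p + 2) (diffUniformity g) := by
  refine diffUniformity_le fun a b ha ↦ ?_
  by_cases haK : a ∈ Set.range (algebraMap K L)
  · obtain ⟨u, rfl⟩ := haK
    have hu : u ≠ 0 := by rintro rfl; exact ha (map_zero _)
    by_cases hbK : b ∈ Set.range (algebraMap K L)
    · obtain ⟨v, rfl⟩ := hbK
      exact le_max_of_le_right <| (diffCount_algebraMap_le hfg hfp hp hu v).trans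
        (diffCount_le_diffUniformity g hu v)
    · exact le_max_of_le_left <| (diffCount_algebraMap_le_of_notMem_range hfg hfp u hbK).trans <|
        (diffCount_le_diffUniformity p ha b).trans (Nat.le_add_right _ _)
  · exact le_max_of_le_left <| (diffCount_le_add_two hfg hfp hp haK b).trans <|
      Nat.add_le_add_right (diffCount_le_diffUniformity p ha b) 2

end DifferentialUniformity

section ModifiedDobbertin

variable {K L : Type*} [Field K] [Fintype K] [Field L] [CharP L 2] [Algebra K L] {k : ℕ}
  (hK : Fintype.card K = 2 ^ k)
include hK

theorem modifiedDobbertin_algebraMap {g : K → K} {G : L → L}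
    (hG : ∀ u : K, G (algebraMap K L u) = algebraMap K L (g u)) (u : K) :
    modifiedDobbertin k G (algebraMap K L u) = algebraMap K L (g u) := by
  have hk : 5 * k ≠ 0 := by
    rintro h
    obtain rfl : k = 0 := by omega
    exact Fintype.one_lt_card.ne' hK
  have hpow : 2 ^ (5 * k) - 1 ≠ 0 := Nat.sub_ne_zero_of_lt (Nat.one_lt_two_pow hk)
  have hfix : algebraMap K L u ^ 2 ^ k = algebraMap K L u := by
    rw [← hK, ← map_pow, FiniteField.pow_card]
  rw [modifiedDobbertin, hfix, CharTwo.add_self_eq_zero, zero_pow hpow, mul_zero, add_zero, hG]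

theorem modifiedDobbertin_of_notMem_range [Fintype L] (hL : Fintype.card L = 2 ^ (5 * k))
    (G : L → L) {x : L} (hx : x ∉ Set.range (algebraMap K L)) :
    modifiedDobbertin k G x = x ^ dobbertinExp k := by
  have hne : x + x ^ 2 ^ k ≠ 0 := fun h ↦
    hx (mem_range_of_pow_card_eq (by rw [hK, ← CharTwo.add_eq_zero.1 h]))
  rw [modifiedDobbertin, ← hL, FiniteField.pow_card_sub_one_eq_one _ hne, mul_one, ← add_assoc,
    CharTwo.add_self_eq_zero, zero_add]

end ModifiedDobbertin

theorem finrank_eq_of_card_eq_pow {K L : Type*} [Field K] [Finite K] [Field L] [Finite L]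
    [Algebra K L] {m : ℕ} (h : Nat.card L = Nat.card K ^ m) : Module.finrank K L = m :=
  Nat.pow_right_injective Finite.one_lt_card (Module.natCard_eq_pow_finrank.symm.trans h)

theorem theorem1_general (k : ℕ)
    (K L : Type*) [Field K] [Fintype K] [Field L] [Fintype L] [Algebra K L]
    (hK : Fintype.card K = 2 ^ k) (hL : Fintype.card L = 2 ^ (5 * k)) (g : K → K)
    (G : L → L) (hG : ∀ x : K, G (algebraMap K L x) = algebraMap K L (g x)) :
    ((∀ x : K, modifiedDobbertin k G (algebraMap K L x) = algebraMap K L (g x)) ∧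
      (∀ x : L, x ∉ Set.range (algebraMap K L) →
        modifiedDobbertin k G x = x ^ dobbertinExp k)) ∧
    (Odd k → Function.Bijective g → Function.Bijective (modifiedDobbertin k G)) ∧
    diffUniformity g ≤ diffUniformity (modifiedDobbertin k G) ∧
    diffUniformity (modifiedDobbertin k G) ≤ max 4 (diffUniformity g) := by
  have : CharP K 2 := charP_of_card_eq_prime_pow hK
  have : CharP L 2 := charP_of_card_eq_prime_pow hL
  have hcard : Nat.card K = 2 ^ k := Nat.card_eq_fintype_card.trans hK
  have h5 : Module.finrank K L = 5 := finrank_eq_of_card_eq_pow <| by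
    rw [Nat.card_eq_fintype_card, hL, hcard, ← pow_mul, mul_comm]
  have hfg := modifiedDobbertin_algebraMap hK hG
  have hfp (x : L) (hx : x ∉ Set.range (algebraMap K L)) :=
    modifiedDobbertin_of_notMem_range hK hL G hx
  have hAPN : diffUniformity (fun x : L ↦ x ^ dobbertinExp k) ≤ 2 :=
    diffUniformity_le_two fun a x y ha ↦
      eq_or_eq_add_of_derivative_pow_dobbertinExp_eq hcard h5 ha
  have hup := diffUniformity_le_max hfg hfp fun a b ha x ↦
    mem_range_of_derivative_pow_dobbertinExp_eq hcard h5 ha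
  refine ⟨⟨hfg, hfp⟩, fun hk hg ↦ ?_, diffUniformity_le_of_extends hfg,
    hup.trans (max_le_max_right _ (Nat.add_le_add_right hAPN 2))⟩
  exact bijective_of_extends hfg hfp hg.injective (pow_dobbertinExp_injective hcard h5 hk)
    fun x ↦ mem_range_of_pow_dobbertinExp_mem_range hcard h5

theorem theorem1 (k : ℕ) (hk : Odd k)
    (K L : Type*) [Field K] [Fintype K] [Field L] [Fintype L] [Algebra K L]
    (hK : Fintype.card K = 2 ^ k) (hL : Fintype.card L = 2 ^ (5 * k))
    (g : K → K) (hg : Function.Bijective g)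
    (G : L → L) (hG : ∀ x : K, G (algebraMap K L x) = algebraMap K L (g x)) :
    ((∀ x : K, modifiedDobbertin k G (algebraMap K L x) = algebraMap K L (g x)) ∧
      (∀ x : L, x ∉ Set.range (algebraMap K L) →
        modifiedDobbertin k G x = x ^ dobbertinExp k)) ∧
    Function.Bijective (modifiedDobbertin k G) ∧
    (IsAPN g → diffUniformity (modifiedDobbertin k G) ≤ 4) ∧
    (IsDiffUniform g 4 → IsDiffUniform (modifiedDobbertin k G) 4) ∧
    (IsDiffUniform g 6 → IsDiffUniform (modifiedDobbertin k G) 6) := by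
  obtain ⟨hvalues, hbij, hlower, hupper⟩ := theorem1_general k K L hK hL g G hG
  simp only [IsAPN, IsDiffUniform]
  exact ⟨hvalues, hbij hk hg, by omega, by omega, by omega⟩
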